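/- Let $\mathbf I$ be a countable set. A configuration is a family $x=(x^i)_{i\in\mathbf I}$ of locally finite subsets of $\mathbb R$ that are pairwise disjoint; it is identified with the point measures $dx^i=\sum_{s\in x^i}\delta_s$, and the space of configurations carries the $\sigma$-algebra generated by the counts $x\mapsto \#(x^i\cap B)$, $B$ Borel. Let $\mathcal X$ be the space of configurations with all points in $(-\infty,0)$, and for a configuration $x$ and $t\in\mathbb R$ let $x_t^{\leftarrow t}=(\{s-t : s\in x^i,\ s<t\})_{i}\in\mathcal X$ be the past of $x$ strictly before $t$, shifted by $-t$. A finite neighborhood is a Borel subset of $\mathbf I\times(-\infty,0)$ contained in $J\times[a,b]$ for some finite $J\subset\mathbf I$ and some $a,b\in\mathbb R$. A function $f$ on $\mathcal X$ is cylindrical on $v$ if $f(x)=f(y)$ whenever $x$ and $y$ have the same points in $v$. For each $i\in\mathbf I$ let $\mathbf V^i$ be a countable family of finite neighborhoods, $\lambda^i$ a probability on $\mathbf V^i$, and, for $v\in\mathbf V^i$, let $\phi^i_v:\mathcal X\to\mathbb R_+$ be measurable and cylindrical on $v$. Let $(\Pi^i)_{i\in\mathbf I}$ be independent Poisson random measures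 on $\mathbb R\times\mathbb R_+\times\mathbf V^i$ with intensity measures $dt\,du\,\lambda^i(dv)$, defined on a probability space, and let $\mathcal G$ be a (possibly trivial) $\sigma$-algebra of events independent of $(\Pi^i)_{i\in\mathbf I}$. Let $X$ be a random configuration, with counting processes $Z=(Z^i)_{i\in\mathbf I}$ (so $dZ^i_t=dX^i_t$), such that for every $t$ the restriction of $X$ to $(-\infty,t]$ is measurable with respect to $\mathcal G$ and the restrictions of all the $\Pi^j$ to $(-\infty,t]\times\mathbb R_+\times\mathbf V^j$, and such that almost surely, for every $i\in\mathbf I$, $$dZ^i_t=\int_{u\ge 0,\ v\in\mathbf V^i}\mathbf 1_{u\le \phi^i_v(X_t^{\leftarrow t})}\,\Pi^i(dt,du,dv).$$ Then, for every $i\in\mathbf I$, $Z^i$ is a time homogeneous counting process with generic intensity $$\phi^i=\sum_{v\in\mathbf V^i}\lambda^i(v)\,\phi^i_v .$$ That is, $\phi^i:\mathcal X\to[0,\infty]$ is measurable and, with $\mathcal F_t$ the $\sigma$-algebra generated by the numbers of points of $X^j$, $j\in\mathbf I$, in Borel subsets of $(-\infty,t]$, the process $t\mapsto\phi^i(X_t^{\leftarrow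 t})$ is $(\mathcal F_t)$-predictable, almost surely integrable on bounded intervals (hence finite for almost every $t$), and is the stochastic intensity of $Z^i$: for every nonnegative $(\mathcal F_t)$-predictable process $C$, $$\mathbb E\int_{\mathbb R} C_t\,dZ^i_t=\mathbb E\int_{\mathbb R} C_t\,\phi^i(X_t^{\leftarrow t})\,dt .$$ -/

import Mathlib

open MeasureTheory ProbabilityTheory Set
open scoped NNReal ENNReal

noncomputable section

namespace Kalikow

/-! ### Configurations -/

/-- A configuration of points on `I × ℝ`: for each `i` a locally finite set of (finite) times, which
is the set of finite values of a sequence `(t^i_n)` that is strictly increasing where finite and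
tends to `±∞` at `±∞`; different components have no common point. -/
structure Config (I : Type*) where
  /-- The set of points of component `i`. -/
  points : I → Set ℝ
  locallyFinite : ∀ i a b, (points i ∩ Icc a b).Finite
  disjoint : ∀ i j, i ≠ j → Disjoint (points i) (points j)

/-- The point measure `∑ₙ δ_{t^i_n}` of component `i`. -/
def Config.pointMeasure {I : Type*} (x : Config I) (i : I) : Measure ℝ :=
  Measure.sum fun s : x.points i => Measure.dirac (s : ℝ)

/-- The σ-algebra generated by all the counts `x ↦ #(x^i ∩ B)`, `B` a Borel set. -/
instance Config.instMeasurableSpace {I : Type*} : MeasurableSpace (Config I) :=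
  MeasurableSpace.comap (fun x i => x.pointMeasure i) inferInstance

/-- The space of past configurations rooted at time `0`: all points are `< 0`. -/
abbrev PastConfig (I : Type*) : Type _ :=
  {x : Config I // ∀ i, x.points i ⊆ Iio 0}

/-- The part of `x` strictly before `t`, shifted by `-t`. -/
def shiftedPast {I : Type*} (x : Config I) (t : ℝ) : PastConfig I where
  val :=
    { points := fun i => {r | r < 0 ∧ r + t ∈ x.points i}
      locallyFinite := by
        intro i a b
        refine ((x.locallyFinite i (a + t) (b + t)).image (fun s => s - t)).subset ?_
        rintro r ⟨⟨-, hr⟩, hra, hrb⟩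
        exact ⟨r + t, ⟨hr, by linarith, by linarith⟩, by ring⟩
      disjoint := by
        intro i j hij
        rw [Set.disjoint_left]
        rintro r ⟨-, hi⟩ ⟨-, hj⟩
        exact Set.disjoint_left.1 (x.disjoint i j hij) hi hj }
  property := fun _ _ hr => hr.1

/-! ### Neighborhoods and cylindrical functions -/

/-- A finite neighborhood: a Borel subset of `I × (-∞, 0)` (`I` countable and discrete) that is
contained in `J × [a, b]` with `J` finite. -/
structure IsFiniteNeighborhood {I : Type*} (v : Set (I × ℝ)) : Prop where
  borel : ∀ i, MeasurableSet {s : ℝ | (i, s) ∈ v}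
  neg : ∀ p ∈ v, p.2 < 0
  bounded : ∃ (J : Finset I) (a b : ℝ), ∀ p ∈ v, p.1 ∈ J ∧ p.2 ∈ Icc a b

/-- `x` and `y` have the same points in `v`. -/
def EqOnNeighborhood {I : Type*} (v : Set (I × ℝ)) (x y : PastConfig I) : Prop :=
  ∀ i s, (i, s) ∈ v → (s ∈ x.1.points i ↔ s ∈ y.1.points i)

/-- `f` is cylindrical in `v`. -/
def IsCylindrical {I β : Type*} (v : Set (I × ℝ)) (f : PastConfig I → β) : Prop :=
  ∀ x y, EqOnNeighborhood v x y → f x = f y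

/-! ### Random measures -/

/-- Lebesgue measure on `[0, ∞)`. -/
def lebesgueNNReal : Measure ℝ≥0 :=
  Measure.comap (fun u : ℝ≥0 => (u : ℝ)) volume

/-- The σ-algebra generated by the masses `ξ(B)`, for the measurable sets `B ⊆ S`. -/
@[reducible]
def sigmaOn {Ω E : Type*} [MeasurableSpace E] (ξ : Ω → Measure E) (S : Set E) :
    MeasurableSpace Ω :=
  ⨆ (B : Set E) (_ : MeasurableSet B) (_ : B ⊆ S),
    MeasurableSpace.comap (fun ω => ξ ω B) inferInstance

/-- `ξ` is a Poisson random measure with intensity measure `μ`. -/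
structure IsPoissonMeasure {Ω E : Type*} [MeasurableSpace Ω] [MeasurableSpace E]
    (P : Measure Ω) (ξ : Ω → Measure E) (μ : Measure E) : Prop where
  measurable : Measurable ξ
  law : ∀ B, MeasurableSet B → μ B ≠ ∞ →
    P.map (fun ω => ξ ω B) = (poissonMeasure (μ B).toNNReal).map (fun n : ℕ => (n : ℝ≥0∞))
  indep : ∀ (n : ℕ) (B : Fin n → Set E), (∀ k, MeasurableSet (B k)) →
    (∀ k l, k ≠ l → Disjoint (B k) (B l)) → iIndepFun (fun k ω => ξ ω (B k)) P

/-! ### Stochastic intensities -/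

/-- The past filtration of the random configuration `X`: the σ-algebra at time `t` is generated by
the numbers of points of all components in Borel subsets of `(-∞, t]`. -/
def pastFiltration {I Ω : Type*} [mΩ : MeasurableSpace Ω] (X : Ω → Config I)
    (hX : Measurable X) : Filtration ℝ mΩ where
  seq t := ⨆ i, sigmaOn (fun ω => (X ω).pointMeasure i) (Iic t)
  mono' := by
    intro s t hst
    refine iSup_mono fun i => iSup_mono fun B => iSup_mono fun _ => ?_
    exact iSup_le fun h => le_iSup_of_le (h.trans (Iic_subset_Iic.2 hst)) le_rfl
  le' := by
    intro t
    refine iSup_le fun i => iSup_le fun B => iSup_le fun hB => iSup_le fun _ => ?_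
    have h1 : Measurable fun x : Config I => fun i => x.pointMeasure i :=
      comap_measurable _
    exact ((Measure.measurable_coe hB).comp
      ((measurable_pi_apply i).comp (h1.comp hX))).comap_le

/-- The predictable σ-algebra on `ℝ × Ω`, generated by the sets `(t, ∞) × A` with `A ∈ ℱ t`. -/
@[reducible]
def predictableSigma {Ω : Type*} {mΩ : MeasurableSpace Ω} (ℱ : Filtration ℝ mΩ) :
    MeasurableSpace (ℝ × Ω) :=
  MeasurableSpace.generateFrom
    {S | ∃ (t : ℝ) (A : Set Ω), MeasurableSet[ℱ t] A ∧ S = Ioi t ×ˢ A}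

/-- The point process `N` admits the (predictable) `ℱ`-stochastic intensity `lam`: it is
`ℱ`-predictable, a.s. locally integrable, and `E ∫ C dN = E ∫ C_t lam_t dt` for every nonnegative
`ℱ`-predictable process `C`. For `C = 1_A 1_{(a,b]}`, `A ∈ ℱ a`, the last condition says
`E[N((a,b]) | ℱ a] = E[∫_a^b lam_t dt | ℱ a]`. -/
structure HasStochasticIntensity {Ω : Type*} {mΩ : MeasurableSpace Ω} (P : Measure Ω)
    (ℱ : Filtration ℝ mΩ) (N : Ω → Measure ℝ) (lam : ℝ → Ω → ℝ≥0∞) : Prop where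
  predictable : Measurable[predictableSigma ℱ] fun p : ℝ × Ω => lam p.1 p.2
  locallyIntegrable : ∀ᵐ ω ∂P, ∀ a b : ℝ, ∫⁻ t in Ioc a b, lam t ω < ∞
  integral_eq : ∀ C : ℝ × Ω → ℝ≥0∞, Measurable[predictableSigma ℱ] C →
    ∫⁻ ω, (∫⁻ t : ℝ, C (t, ω) ∂(N ω)) ∂P = ∫⁻ ω, (∫⁻ t : ℝ, C (t, ω) * lam t ω) ∂P

/-- The counting process of component `i` of the random configuration `X` is time homogeneous with
generic intensity `φ`: its stochastic intensity at time `t`, with respect to the past filtration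
of `X`, is `φ (X_t^{←t})`. (Values in `[0, ∞]` are allowed so that `φ` can be given by a series;
local integrability makes `φ (X_t^{←t})` finite for almost every `t`, almost surely.) -/
structure HasGenericIntensity {I Ω : Type*} [MeasurableSpace Ω] (P : Measure Ω)
    (X : Ω → Config I) (hX : Measurable X) (i : I) (φ : PastConfig I → ℝ≥0∞) : Prop where
  measurable : Measurable φ
  intensity : HasStochasticIntensity P (pastFiltration X hX) (fun ω => (X ω).pointMeasure i)
    (fun t ω => φ (shiftedPast (X ω) t))

/-! ### Thinning -/

/-- The thinned measure `B ↦ ∫ 1_{t ∈ B} 1_{u ≤ φ_v(x_t^{←t})} π(dt, du, dv)` on `ℝ`. -/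
def thinning {I V : Type*} [MeasurableSpace V] (π : Measure (ℝ × ℝ≥0 × V))
    (φ : V → PastConfig I → ℝ≥0) (x : Config I) : Measure ℝ :=
  (π.restrict {p | p.2.1 ≤ φ p.2.2 (shiftedPast x p.1)}).map Prod.fst

end Kalikow

end

/-!
Fix `i`. By the thinning equation, the integral of a process `C` against the points of `X^i` is the
integral against `Π^i(dt, du, dv)` of `H = C_t 1{u ≤ φ^i_v(X_t^{←t})}`. When `C` is predictable for
the past of `X`, so is `H` for the joint history of `𝒢` and of all the Poisson measures, because `X`
is adapted to that history and `X_t^{←t}` only looks strictly before `t`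
(`predictable_shiftedPast`). The compensation formula `IsPoissonMeasure.lintegral_predictable`
replaces `Π^i(dt, du, dv)` by `dt du λ^i(dv)` under the expectation, and integrating `u` and `v` out
of `H` leaves `C_t ∑_v λ^i(v) φ^i_v(X_t^{←t})` (`prod_lebesgueNNReal_subgraph`).

The compensation formula is an equality of two σ-finite measures on a predictable σ-algebra. On the
generating rectangles `(s, r] × A × D` it follows from the independence of `A`, an event of the
history up to time `s`, and the mass `Π^i((s, r] × D)`, whose mean is given by the intensity measure
(`indep_history`, `IsPoissonMeasure.lintegral_apply`). The independence within one Poisson measure,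
`IsPoissonMeasure.indep_sigmaOn`, is reduced to that of the masses of disjoint sets by passing to
the atoms of finite partitions.

Local integrability of the intensity is a consequence of the same formula
(`ae_lintegral_lt_top`): collecting the points of a bounded interval only as long as few have
occurred makes the left side of the formula finite, and this truncation is eventually void because
configurations are locally finite.
-/

namespace Kalikow

/-! ### Measurable families of measures -/

section Kernels

variable {α β : Type*} [MeasurableSpace α] [MeasurableSpace β]

/-- A measurable family of measures is an s-finite kernel as soon as each of its members is finite
on each set of a fixed countable cover; no bound uniform in the parameter is needed. On a piece of
the cover, the family is a density times its normalization, which has mass at most one. -/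
theorem isSFiniteKernel_of_cover (κ : Kernel α β) (B : ℕ → Set β) (hB : ∀ n, MeasurableSet (B n))
    (hU : ⋃ n, B n = univ) (hfin : ∀ n a, κ a (B n) ≠ ∞) : IsSFiniteKernel κ := by
  have hD : ∀ n, MeasurableSet (disjointed B n) := MeasurableSet.disjointed hB
  have hDfin : ∀ n a, κ a (disjointed B n) ≠ ∞ := fun n a =>
    ((measure_mono (disjointed_subset B n)).trans_lt (hfin n a).lt_top).ne
  have hmeas : ∀ n, Measurable fun a => 1 + κ a (disjointed B n) := fun n =>
    measurable_const.add (κ.measurable_coe (hD n))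
  have hsum : κ = Kernel.sum fun n => κ.restrict (hD n) := by
    ext a s hs
    rw [Kernel.sum_apply' _ _ hs]
    simp_rw [Kernel.restrict_apply' _ (hD _) _ hs]
    rw [← measure_iUnion, ← inter_iUnion, iUnion_disjointed, hU, inter_univ]
    · exact fun m n hmn => (disjoint_disjointed B hmn).mono inter_subset_right inter_subset_right
    · exact fun n => hs.inter (hD n)
  rw [hsum]
  suffices h : ∀ n, IsSFiniteKernel (κ.restrict (hD n)) from Kernel.isSFiniteKernel_sum
  intro n
  let η : Kernel α β :=
    { toFun := fun a => (1 + κ a (disjointed B n))⁻¹ • κ.restrict (hD n) a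
      measurable' := by
        refine Measure.measurable_of_measurable_coe _ fun s hs => ?_
        simp only [Measure.smul_apply, smul_eq_mul]
        exact (hmeas n).inv.mul ((κ.restrict (hD n)).measurable_coe hs) }
  have hη : ∀ a, η a = (1 + κ a (disjointed B n))⁻¹ • κ.restrict (hD n) a := fun _ => rfl
  have : IsFiniteKernel η := by
    refine ⟨⟨1, ENNReal.one_lt_top, fun a => ?_⟩⟩
    rw [hη, Measure.smul_apply, smul_eq_mul, Kernel.restrict_apply' _ _ _ MeasurableSet.univ,
      univ_inter, mul_comm, ← div_eq_mul_inv]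
    exact ENNReal.div_le_of_le_mul (by rw [one_mul]; exact le_add_self)
  have hwd : κ.restrict (hD n) = η.withDensity fun a _ => 1 + κ a (disjointed B n) := by
    ext a s hs
    rw [Kernel.withDensity_apply' _ (by exact (hmeas n).comp measurable_fst)]
    rw [lintegral_const, Measure.restrict_apply MeasurableSet.univ, univ_inter, hη,
      Measure.smul_apply, smul_eq_mul, ← mul_assoc, ENNReal.mul_inv_cancel, one_mul]
    · simp
    · exact ENNReal.add_ne_top.2 ⟨ENNReal.one_ne_top, hDfin n a⟩
  rw [hwd]
  exact Kernel.IsSFiniteKernel.withDensity _ fun a _ =>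
    ENNReal.add_ne_top.2 ⟨ENNReal.one_ne_top, hDfin n a⟩

theorem measurable_lintegral_of_cover {κ : α → Measure β} (hκ : Measurable κ) (B : ℕ → Set β)
    (hB : ∀ n, MeasurableSet (B n)) (hU : ⋃ n, B n = univ) (hfin : ∀ n a, κ a (B n) ≠ ∞)
    {f : α × β → ℝ≥0∞} (hf : Measurable f) : Measurable fun a => ∫⁻ b, f (a, b) ∂κ a := by
  have := isSFiniteKernel_of_cover ⟨κ, hκ⟩ B hB hU hfin
  exact hf.lintegral_kernel_prod_right' (κ := ⟨κ, hκ⟩)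

end Kernels

/-- Uniqueness of measures, for the push-forwards of `μ` and `ν` by `f` to a σ-algebra `m` on the
target that is generated by a π-system. -/
theorem lintegral_comp_eq_of_isPiSystem {α β : Type*} [MeasurableSpace α] {m : MeasurableSpace β}
    {μ ν : Measure α} {f : α → β} (hf : Measurable f) (C : Set (Set β))
    (hm : m = MeasurableSpace.generateFrom C) (hC : IsPiSystem C) (B : ℕ → Set β)
    (hU : ⋃ n, B n = univ) (hBC : ∀ n, B n ∈ C) (hfin : ∀ n, μ (f ⁻¹' B n) ≠ ∞)
    (h : ∀ s ∈ C, μ (f ⁻¹' s) = ν (f ⁻¹' s)) {g : β → ℝ≥0∞} (hg : Measurable g) :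
    ∫⁻ a, g (f a) ∂μ = ∫⁻ a, g (f a) ∂ν := by
  have hCm : ∀ s ∈ C, MeasurableSet s := fun s hs => by
    rw [hm]; exact MeasurableSpace.measurableSet_generateFrom hs
  have : μ.map f = ν.map f := by
    refine Measure.ext_of_generateFrom_of_iUnion C B hm hC hU hBC (fun n => ?_) fun s hs => ?_
    · rw [Measure.map_apply hf (hCm _ (hBC n))]; exact hfin n
    · rw [Measure.map_apply hf (hCm s hs), Measure.map_apply hf (hCm s hs)]; exact h s hs
  rw [← lintegral_map hg hf, this, lintegral_map hg hf]

/-! ### Independence of σ-algebras -/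

theorem indep_sup_left {Ω : Type*} {m₁ m₂ m₃ mΩ : MeasurableSpace Ω} {P : Measure Ω}
    [IsProbabilityMeasure P] (h₁ : m₁ ≤ mΩ) (h₂ : m₂ ≤ mΩ) (h₃ : m₃ ≤ mΩ)
    (h : Indep m₁ (m₂ ⊔ m₃) P) (h' : Indep m₂ m₃ P) : Indep (m₁ ⊔ m₂) m₃ P := by
  rw [Indep_iff] at h h'
  let C : Set (Set Ω) := {s | ∃ a b, MeasurableSet[m₁] a ∧ MeasurableSet[m₂] b ∧ s = a ∩ b}
  have hgen : m₁ ⊔ m₂ = MeasurableSpace.generateFrom C := by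
    refine le_antisymm (sup_le (fun a ha => ?_) fun b hb => ?_) ?_
    · exact MeasurableSpace.measurableSet_generateFrom
        ⟨a, univ, ha, MeasurableSet.univ, (inter_univ a).symm⟩
    · exact MeasurableSpace.measurableSet_generateFrom
        ⟨univ, b, MeasurableSet.univ, hb, (univ_inter b).symm⟩
    · refine MeasurableSpace.generateFrom_le ?_
      rintro _ ⟨a, b, ha, hb, rfl⟩
      exact MeasurableSet.inter (le_sup_left (a := m₁) (b := m₂) a ha)
        (le_sup_right (a := m₁) (b := m₂) b hb)
  refine IndepSets.indep (p1 := C) (p2 := {s | MeasurableSet[m₃] s}) (sup_le h₁ h₂) h₃ ?_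
    (@MeasurableSpace.isPiSystem_measurableSet Ω m₃) hgen
    (@MeasurableSpace.generateFrom_measurableSet Ω m₃).symm ?_
  · rintro _ ⟨a, b, ha, hb, rfl⟩ _ ⟨a', b', ha', hb', rfl⟩ -
    exact ⟨a ∩ a', b ∩ b', ha.inter ha', hb.inter hb', inter_inter_inter_comm a b a' b'⟩
  · rw [IndepSets_iff]
    rintro _ c ⟨a, b, ha, hb, rfl⟩ hc
    have hbc : MeasurableSet[m₂ ⊔ m₃] (b ∩ c) :=
      MeasurableSet.inter (le_sup_left (a := m₂) (b := m₃) b hb)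
        (le_sup_right (a := m₂) (b := m₃) c hc)
    rw [inter_assoc, h a _ ha hbc, h' b c hb hc,
      h a b ha (le_sup_left (a := m₂) (b := m₃) b hb), mul_assoc]

/-! ### Poisson random measures -/

section Poisson

theorem lintegral_cast_poissonMeasure (r : ℝ≥0) :
    ∫⁻ n : ℕ, (n : ℝ≥0∞) ∂poissonMeasure r = r := by
  have hterm : ∀ n : ℕ, ENNReal.ofReal (Real.exp (-r) * r ^ (n + 1) / (n + 1).factorial) *
      ((n + 1 : ℕ) : ℝ≥0∞) = r * ENNReal.ofReal (Real.exp (-r) * r ^ n / n.factorial) := by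
    intro n
    rw [← ENNReal.ofReal_natCast (n + 1), ← ENNReal.ofReal_mul (by positivity),
      ← ENNReal.ofReal_coe_nnreal (p := r), ← ENNReal.ofReal_mul (by positivity)]
    congr 1
    have : ((n + 1).factorial : ℝ) = (n + 1) * n.factorial := by
      exact_mod_cast Nat.factorial_succ n
    rw [this]
    push_cast
    field_simp
    ring
  have hone : ∑' n : ℕ, ENNReal.ofReal (Real.exp (-r) * r ^ n / n.factorial) = 1 := by
    rw [← ENNReal.ofReal_tsum_of_nonneg (fun n => by positivity)
      (hasSum_one_poissonMeasure r).summable, (hasSum_one_poissonMeasure r).tsum_eq,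
      ENNReal.ofReal_one]
  rw [lintegral_countable']
  simp_rw [poissonMeasure_singleton, mul_comm ((_ : ℕ) : ℝ≥0∞)]
  rw [tsum_eq_zero_add' ENNReal.summable]
  simp_rw [hterm]
  rw [ENNReal.tsum_mul_left, hone]
  simp

theorem sigmaOn_le_comap {Ω E : Type*} [MeasurableSpace E] {ξ : Ω → Measure E} (S : Set E) :
    sigmaOn ξ S ≤ MeasurableSpace.comap ξ inferInstance :=
  iSup_le fun _ => iSup_le fun hB => iSup_le fun _ =>
    ((Measure.measurable_coe hB).comp (comap_measurable ξ)).comap_le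

theorem comap_apply_le_sigmaOn {Ω E : Type*} [MeasurableSpace E] {ξ : Ω → Measure E}
    {S B : Set E} (hB : MeasurableSet B) (hBS : B ⊆ S) :
    MeasurableSpace.comap (fun ω => ξ ω B) inferInstance ≤ sigmaOn ξ S :=
  le_iSup_of_le B (le_iSup_of_le hB (le_iSup_of_le hBS le_rfl))

variable {Ω E : Type*} [mΩ : MeasurableSpace Ω] [MeasurableSpace E] {P : Measure Ω}
  {ξ : Ω → Measure E} {μ : Measure E}

theorem IsPoissonMeasure.measurable_apply (h : IsPoissonMeasure P ξ μ) {B : Set E}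
    (hB : MeasurableSet B) : Measurable fun ω => ξ ω B :=
  (Measure.measurable_coe hB).comp h.measurable

/-- The mean of a Poisson random measure is its intensity. -/
theorem IsPoissonMeasure.lintegral_apply [SigmaFinite μ] (h : IsPoissonMeasure P ξ μ) {B : Set E}
    (hB : MeasurableSet B) : ∫⁻ ω, ξ ω B ∂P = μ B := by
  have hfin : ∀ B, MeasurableSet B → μ B ≠ ∞ → ∫⁻ ω, ξ ω B ∂P = μ B := by
    intro B hB hμB
    have hid : ∫⁻ ω, ξ ω B ∂P = ∫⁻ x, x ∂(P.map fun ω => ξ ω B) :=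
      (lintegral_map measurable_id (h.measurable_apply hB)).symm
    rw [hid, h.law B hB hμB, lintegral_map (f := fun x : ℝ≥0∞ => x) measurable_id .of_discrete,
      lintegral_cast_poissonMeasure, ENNReal.coe_toNNReal hμB]
  let D : ℕ → Set E := fun n => B ∩ disjointed (spanningSets μ) n
  have hD : ∀ n, MeasurableSet (D n) := fun n =>
    hB.inter (MeasurableSet.disjointed (measurableSet_spanningSets μ) n)
  have hdisj : Pairwise (Function.onFun Disjoint D) := fun m n hmn =>
    (disjoint_disjointed (spanningSets μ) hmn).mono inter_subset_right inter_subset_right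
  have hU : B = ⋃ n, D n := by
    rw [← inter_iUnion, iUnion_disjointed, iUnion_spanningSets, inter_univ]
  rw [hU]
  simp_rw [measure_iUnion hdisj hD]
  rw [lintegral_tsum fun n => (h.measurable_apply (hD n)).aemeasurable]
  refine tsum_congr fun n => hfin _ (hD n) ?_
  exact ((measure_mono (inter_subset_right.trans (disjointed_subset _ n))).trans_lt
    (measure_spanningSets_lt_top μ n)).ne

theorem IsPoissonMeasure.iIndepFun_of_fintype (h : IsPoissonMeasure P ξ μ) {J : Type*} [Fintype J]
    (B : J → Set E) (hB : ∀ j, MeasurableSet (B j)) (hd : ∀ j k, j ≠ k → Disjoint (B j) (B k)) :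
    iIndepFun (fun j ω => ξ ω (B j)) P := by
  have := h.indep _ (B ∘ (Fintype.equivFin J).symm) (fun k => hB _)
    fun k l hkl => hd _ _ ((Fintype.equivFin J).symm.injective.ne hkl)
  simpa using this.precomp (Fintype.equivFin J).injective

/-- Only masses of pairwise disjoint sets are independent by definition: finitely many sets are
therefore cut into the atoms of the finite partition which they generate. -/
theorem IsPoissonMeasure.indep_iSup_comap (h : IsPoissonMeasure P ξ μ) {ι : Type*} [Finite ι]
    {S B : Set E} (hS : MeasurableSet S) (hB : MeasurableSet B) (hSB : Disjoint S B)
    (D : ι → Set E) (hD : ∀ k, MeasurableSet (D k)) (hDS : ∀ k, D k ⊆ S) :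
    Indep (⨆ k, MeasurableSpace.comap (fun ω => ξ ω (D k)) inferInstance)
      (MeasurableSpace.comap (fun ω => ξ ω B) inferInstance) P := by
  classical
  have := Fintype.ofFinite ι
  let c : E → ι → Prop := fun x k => x ∈ D k
  have hc : Measurable c := measurable_pi_lambda _ fun k => measurable_mem.2 (hD k)
  let A : (ι → Prop) → Set E := fun a => c ⁻¹' {a} ∩ S
  have hA : ∀ a, MeasurableSet (A a) := fun a => (hc (measurableSet_singleton a)).inter hS
  have hAd : ∀ a b, a ≠ b → Disjoint (A a) (A b) := by
    intro a b hab
    rw [Set.disjoint_left]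
    rintro x ⟨hxa, -⟩ ⟨hxb, -⟩
    exact hab (hxa.symm.trans hxb)
  have hDA : ∀ k, D k = ⋃ a : {a : ι → Prop // a k}, A a := by
    intro k
    ext x
    simp only [mem_iUnion]
    constructor
    · exact fun hx => ⟨⟨c x, hx⟩, rfl, hDS k hx⟩
    · rintro ⟨⟨a, ha⟩, hx, -⟩
      have : c x = a := hx
      rw [← this] at ha
      exact ha
  -- `none` stands for `B`, the other indices for the atoms of the partition of `S`
  let F : Option (ι → Prop) → Set E := fun o => o.elim B A
  have hF : iIndepFun (fun o ω => ξ ω (F o)) P := by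
    refine h.iIndepFun_of_fintype F ?_ ?_
    · rintro (_ | a)
      · exact hB
      · exact hA a
    · rintro (_ | a) (_ | b) hab
      · exact absurd rfl hab
      · exact (hSB.mono_left inter_subset_right).symm
      · exact hSB.mono_left inter_subset_right
      · exact hAd a b fun h => hab (congrArg some h)
  have hm : ∀ o, MeasurableSet (F o) := by
    rintro (_ | a)
    · exact hB
    · exact hA a
  have hind := indep_iSup_of_disjoint (fun o => (h.measurable_apply (hm o)).comap_le) hF
    (S := {none}ᶜ) (T := {none}) disjoint_compl_left
  refine indep_of_indep_of_le hind (iSup_le fun k => ?_) ?_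
  · refine Measurable.comap_le ?_
    have hk : (fun ω => ξ ω (D k)) = fun ω => ∑' a : {a : ι → Prop // a k}, ξ ω (A a) := by
      funext ω
      rw [hDA k, measure_iUnion (fun a b hab => hAd _ _ (Subtype.coe_injective.ne hab))
        fun a => hA _]
    rw [hk]
    simp_rw [tsum_fintype]
    refine @Finset.measurable_fun_sum _ _ _ _ _ _ (_) _ _ fun a _ => ?_
    refine Measurable.mono (comap_measurable _) ?_ le_rfl
    exact le_iSup₂_of_le (some a.1) (by simp) le_rfl
  · exact le_iSup₂_of_le none rfl le_rfl

theorem sigmaOn_le (hξ : Measurable ξ) (S : Set E) : sigmaOn ξ S ≤ mΩ :=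
  iSup_le fun _ => iSup_le fun hB => iSup_le fun _ =>
    ((Measure.measurable_coe hB).comp hξ).comap_le

/-- Complete independence: the restriction of a Poisson random measure to `S` is independent of the
mass of a set disjoint from `S`. -/
theorem IsPoissonMeasure.indep_sigmaOn [IsProbabilityMeasure P] (h : IsPoissonMeasure P ξ μ)
    {S B : Set E} (hS : MeasurableSet S) (hB : MeasurableSet B) (hSB : Disjoint S B) :
    Indep (sigmaOn ξ S) (MeasurableSpace.comap (fun ω => ξ ω B) inferInstance) P := by
  let U : Type _ := {D : Set E // MeasurableSet D ∧ D ⊆ S}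
  let m : Finset U → MeasurableSpace Ω := fun F =>
    ⨆ D : F, MeasurableSpace.comap (fun ω => ξ ω D.1.1) inferInstance
  have hle : ∀ F, m F ≤ mΩ := fun F => iSup_le fun D => (h.measurable_apply D.1.2.1).comap_le
  have hmono : Monotone m := fun F G hFG =>
    iSup_le fun D => le_iSup_of_le (⟨D.1, hFG D.2⟩ : G) le_rfl
  have hind : Indep (⨆ F, m F) (MeasurableSpace.comap (fun ω => ξ ω B) inferInstance) P := by
    classical
    exact indep_iSup_of_monotone (fun F => h.indep_iSup_comap hS hB hSB _ (fun D => D.1.2.1)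
      fun D => D.1.2.2) hle (h.measurable_apply hB).comap_le hmono
  refine indep_of_indep_of_le_left hind ?_
  refine iSup_le fun D => iSup_le fun hD => iSup_le fun hDS => ?_
  exact le_iSup_of_le {(⟨D, hD, hDS⟩ : U)}
    (le_iSup_of_le (⟨⟨D, hD, hDS⟩, Finset.mem_singleton_self _⟩ : ({⟨D, hD, hDS⟩} : Finset U))
      le_rfl)

/-- For a family of independent Poisson random measures and a σ-algebra `𝒢` independent of it, the
history before time `t` is independent of what each of the measures does after time `t`. -/
theorem indep_history {I : Type*} {E : I → Type*} [∀ i, MeasurableSpace (E i)]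
    {μ : ∀ i, Measure (E i)} {Ω : Type*} {𝒢 : MeasurableSpace Ω}
    [mΩ : MeasurableSpace Ω] {P : Measure Ω} [IsProbabilityMeasure P] {π : ∀ i, Ω → Measure (E i)}
    (hπ : ∀ i, IsPoissonMeasure P (π i) (μ i)) (hind : iIndepFun π P)
    (h𝒢 : 𝒢 ≤ mΩ) (h𝒢ind : Indep 𝒢 (⨆ i, MeasurableSpace.comap (π i) inferInstance) P)
    (S : ∀ i, Set (E i)) (i : I) (hS : MeasurableSet (S i)) {B : Set (E i)} (hB : MeasurableSet B)
    (hSB : Disjoint (S i) B) :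
    Indep (𝒢 ⊔ ⨆ j, sigmaOn (π j) (S j)) (MeasurableSpace.comap (fun ω => π i ω B) inferInstance)
      P := by
  let m : I → MeasurableSpace Ω := fun j => MeasurableSpace.comap (π j) inferInstance
  have hm : ∀ j, m j ≤ mΩ := fun j => (hπ j).measurable.comap_le
  have hBi : MeasurableSpace.comap (fun ω => π i ω B) inferInstance ≤ m i :=
    ((Measure.measurable_coe hB).comp (comap_measurable (π i))).comap_le
  have hSi : sigmaOn (π i) (S i) ≤ m i := sigmaOn_le_comap (S i)
  have hSB' := (hπ i).indep_sigmaOn hS hB hSB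
  let 𝒜 : MeasurableSpace Ω := ⨆ j ∈ ({i}ᶜ : Set I), m j
  have h𝒜 : 𝒜 ≤ mΩ := iSup₂_le fun j _ => hm j
  have h1 : Indep 𝒜 (m i) P := by
    refine indep_of_indep_of_le_right (indep_iSup_of_disjoint hm hind (S := {i}ᶜ) (T := {i})
      disjoint_compl_left) ?_
    exact le_iSup₂_of_le i rfl le_rfl
  have h2 : Indep (𝒜 ⊔ sigmaOn (π i) (S i))
      (MeasurableSpace.comap (fun ω => π i ω B) inferInstance) P :=
    indep_sup_left h𝒜 (hSi.trans (hm i)) (hBi.trans (hm i))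
      (indep_of_indep_of_le_right h1 (sup_le hSi hBi)) hSB'
  have hA : 𝒜 ≤ ⨆ j, m j := iSup₂_le fun j _ => le_iSup m j
  have h3 := indep_sup_left h𝒢 (sup_le h𝒜 (hSi.trans (hm i))) (hBi.trans (hm i))
    (indep_of_indep_of_le_right h𝒢ind
      (sup_le (sup_le hA (hSi.trans (le_iSup m i))) (hBi.trans (le_iSup m i)))) h2
  refine indep_of_indep_of_le_left h3 (sup_le_sup_left (iSup_le fun j => ?_) 𝒢)
  rcases eq_or_ne j i with rfl | hj
  · exact le_sup_right
  · exact le_sup_of_le_left (le_iSup₂_of_le j hj (sigmaOn_le_comap (S j)))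

end Poisson

/-! ### The predictable σ-algebra and the compensation formula -/

section Predictable

variable {Ω : Type*} [mΩ : MeasurableSpace Ω]

/-- The rectangles `(s, r] × A` with `A` in the σ-algebra at time `s`. -/
def predictableRectangles (ℱ : Filtration ℝ mΩ) : Set (Set (ℝ × Ω)) :=
  {S | ∃ (s r : ℝ) (A : Set Ω), MeasurableSet[ℱ s] A ∧ S = Ioc s r ×ˢ A}

theorem isPiSystem_predictableRectangles (ℱ : Filtration ℝ mΩ) :
    IsPiSystem (predictableRectangles ℱ) := by
  rintro _ ⟨s, r, A, hA, rfl⟩ _ ⟨s', r', A', hA', rfl⟩ -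
  refine ⟨max s s', min r r', A ∩ A', ?_, ?_⟩
  · exact MeasurableSet.inter (ℱ.mono (le_max_left s s') A hA) (ℱ.mono (le_max_right s s') A' hA')
  · rw [prod_inter_prod, Ioc_inter_Ioc]

theorem iUnion_Ioc_neg_nat : ⋃ n : ℕ, Ioc (-(n : ℝ)) n = univ := by
  refine eq_univ_of_forall fun t => mem_iUnion.2 ?_
  obtain ⟨n, hn⟩ := exists_nat_gt |t|
  exact ⟨n, (abs_lt.1 hn).1, (abs_lt.1 hn).2.le⟩

theorem generateFrom_predictableRectangles (ℱ : Filtration ℝ mΩ) :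
    MeasurableSpace.generateFrom (predictableRectangles ℱ) = predictableSigma ℱ := by
  refine le_antisymm (MeasurableSpace.generateFrom_le ?_) (MeasurableSpace.generateFrom_le ?_)
  · rintro _ ⟨s, r, A, hA, rfl⟩
    have h : Ioc s r ×ˢ A = Ioi s ×ˢ A \ Ioi (max s r) ×ˢ A := by
      ext ⟨t, ω⟩
      simp only [mem_prod, mem_Ioc, mem_sdiff, mem_Ioi, max_lt_iff, not_and]
      constructor
      · rintro ⟨⟨h1, h2⟩, h3⟩
        exact ⟨⟨h1, h3⟩, fun h => absurd h.2 (not_lt.2 h2)⟩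
      · rintro ⟨⟨h1, h3⟩, h⟩
        exact ⟨⟨h1, not_lt.1 fun h2 => h ⟨h1, h2⟩ h3⟩, h3⟩
    rw [h]
    exact MeasurableSet.diff (MeasurableSpace.measurableSet_generateFrom ⟨s, A, hA, rfl⟩)
      (MeasurableSpace.measurableSet_generateFrom
        ⟨max s r, A, ℱ.mono (le_max_left s r) A hA, rfl⟩)
  · rintro _ ⟨s, A, hA, rfl⟩
    have h : Ioi s ×ˢ A = ⋃ n : ℕ, Ioc s (n : ℝ) ×ˢ A := by
      rw [← iUnion_prod_const]
      congr 1
      ext t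
      simp only [mem_Ioi, mem_iUnion, mem_Ioc, exists_and_left, iff_self_and]
      exact fun _ => exists_nat_ge t
    rw [h]
    exact MeasurableSet.iUnion fun n =>
      MeasurableSpace.measurableSet_generateFrom ⟨s, n, A, hA, rfl⟩

theorem predictableSigma_le (ℱ : Filtration ℝ mΩ) :
    predictableSigma ℱ ≤ Prod.instMeasurableSpace := by
  refine MeasurableSpace.generateFrom_le ?_
  rintro _ ⟨s, A, hA, rfl⟩
  exact measurableSet_Ioi.prod (ℱ.le s A hA)

theorem predictableSigma_mono {ℱ ℋ : Filtration ℝ mΩ} (h : ∀ t, ℱ t ≤ ℋ t) :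
    predictableSigma ℱ ≤ predictableSigma ℋ := by
  refine MeasurableSpace.generateFrom_mono ?_
  rintro _ ⟨s, A, hA, rfl⟩
  exact ⟨s, A, h s A hA, rfl⟩

/-- A deterministic function of time is predictable. -/
theorem comap_fst_le_predictableSigma (ℱ : Filtration ℝ mΩ) :
    MeasurableSpace.comap Prod.fst inferInstance ≤ predictableSigma ℱ := by
  rw [BorelSpace.measurable_eq (α := ℝ), borel_eq_generateFrom_Ioi,
    MeasurableSpace.comap_generateFrom]
  refine MeasurableSpace.generateFrom_mono ?_
  rintro _ ⟨_, ⟨s, rfl⟩, rfl⟩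
  exact ⟨s, univ, MeasurableSet.univ, by ext; simp⟩

/-- The compensation formula: a Poisson random measure `ξ` on `ℝ × F` with intensity `dt ν(dz)`,
whose masses after time `s` are independent of the history `ℋ s`, can be replaced by its intensity
under the expectation of the integral of a predictable function. For `H` the indicator of
`(s, r] × A × D` this is the independence of `A` and `ξ ((s, r] × D)`, and such sets form a
π-system. -/
theorem IsPoissonMeasure.lintegral_predictable {F : Type*} [mF : MeasurableSpace F]
    {P : Measure Ω} [IsProbabilityMeasure P] {ξ : Ω → Measure (ℝ × F)} {ν : Measure F}
    [SigmaFinite ν] (h : IsPoissonMeasure P ξ ((volume : Measure ℝ).prod ν)) (ℋ : Filtration ℝ mΩ)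
    (hind : ∀ (s : ℝ) (B : Set (ℝ × F)), MeasurableSet B → B ⊆ {p | s < p.1} →
      Indep (ℋ s) (MeasurableSpace.comap (fun ω => ξ ω B) inferInstance) P)
    {H : (ℝ × Ω) × F → ℝ≥0∞} (hH : Measurable[(predictableSigma ℋ).prod mF] H) :
    ∫⁻ ω, ∫⁻ p, H ((p.1, ω), p.2) ∂ξ ω ∂P = ∫⁻ ω, (∫⁻ t : ℝ, ∫⁻ z, H ((t, ω), z) ∂ν) ∂P := by
  set μ : Measure (ℝ × F) := (volume : Measure ℝ).prod ν
  -- `ξ` is made finite on the sets `spanningSets μ n` everywhere, by a change on a null event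
  let G : Set Ω := {ω | ∀ n, ξ ω (spanningSets μ n) ≠ ∞}
  have hG : MeasurableSet G := by
    have : G = ⋂ n, {ω | ξ ω (spanningSets μ n) ≠ ∞} := by ext; simp [G]
    rw [this]
    exact MeasurableSet.iInter fun n =>
      (h.measurable_apply (measurableSet_spanningSets μ n))
        (measurableSet_singleton (∞ : ℝ≥0∞)).compl
  have hGae : ∀ᵐ ω ∂P, ω ∈ G := by
    refine ae_all_iff.2 fun n => ?_
    have hn := measurableSet_spanningSets μ n
    refine (ae_lt_top (h.measurable_apply hn) ?_).mono fun ω hω => hω.ne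
    rw [h.lintegral_apply hn]
    exact (measure_spanningSets_lt_top μ n).ne
  classical
  let κ : Kernel Ω (ℝ × F) := Kernel.piecewise hG ⟨ξ, h.measurable⟩ 0
  have hκ : ∀ᵐ ω ∂P, κ ω = ξ ω := hGae.mono fun ω hω => if_pos hω
  have : IsSFiniteKernel κ := by
    refine isSFiniteKernel_of_cover κ (spanningSets μ) (measurableSet_spanningSets μ)
      (iUnion_spanningSets μ) fun n ω => ?_
    by_cases hω : ω ∈ G
    · have : κ ω = ξ ω := if_pos hω
      rw [this]; exact hω n
    · have : κ ω = 0 := if_neg hω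
      rw [this]; simp
  let f : Ω × ℝ × F → (ℝ × Ω) × F := fun q => ((q.2.1, q.1), q.2.2)
  have hf₀ : Measurable f := by fun_prop
  have hle : (predictableSigma ℋ).prod mF ≤ Prod.instMeasurableSpace :=
    sup_le_sup (MeasurableSpace.comap_mono (predictableSigma_le ℋ)) le_rfl
  have hf : Measurable[_, (predictableSigma ℋ).prod mF] f := hf₀.mono le_rfl hle
  have hH₀ : Measurable H := hH.mono hle le_rfl
  let C : Set (Set ((ℝ × Ω) × F)) :=
    image2 (· ×ˢ ·) (predictableRectangles ℋ) {D : Set F | MeasurableSet D}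
  have hC : (predictableSigma ℋ).prod mF = MeasurableSpace.generateFrom C := by
    rw [← generateFrom_predictableRectangles]
    conv_lhs => rw [← @MeasurableSpace.generateFrom_measurableSet F mF]
    refine generateFrom_prod_eq ⟨fun n : ℕ => Ioc (-(n : ℝ)) n ×ˢ univ,
      fun n => ⟨-n, n, univ, MeasurableSet.univ, rfl⟩, ?_⟩ isCountablySpanning_measurableSet
    rw [← iUnion_prod_const, iUnion_Ioc_neg_nat, univ_prod_univ]
  have hpre : ∀ (s r : ℝ) (A : Set Ω) (D : Set F),
      f ⁻¹' ((Ioc s r ×ˢ A) ×ˢ D) = A ×ˢ (Ioc s r ×ˢ D) := by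
    intro s r A D
    ext ⟨ω, t, z⟩
    simp only [f, mem_preimage, mem_prod]
    tauto
  have hrect : ∀ S ∈ C, (P ⊗ₘ κ) (f ⁻¹' S) = (P.prod μ) (f ⁻¹' S) := by
    rintro _ ⟨_, ⟨s, r, A, hA, rfl⟩, D, hD, rfl⟩
    have hB : MeasurableSet (Ioc s r ×ˢ D : Set (ℝ × F)) := measurableSet_Ioc.prod hD
    have hA₀ := ℋ.le s A hA
    have hAB := hind s _ hB fun p hp => hp.1.1
    simp only [hpre]
    rw [Measure.compProd_apply_prod hA₀ hB, Measure.prod_prod,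
      setLIntegral_congr_fun_ae hA₀ (hκ.mono fun ω hω _ => by rw [hω]), mul_comm (P A),
      ← h.lintegral_apply hB]
    have := lintegral_mul_indicator_eq_lintegral_mul_lintegral_indicator
      (h.measurable_apply hB).comap_le 1 hA₀
      (by
        have hAB' : IndepSets {S | MeasurableSet[MeasurableSpace.comap (fun ω => ξ ω (Ioc s r ×ˢ D))
            inferInstance] S} {S | MeasurableSet[ℋ s] S} P := hAB.symm
        exact indepSets_of_indepSets_of_le_right hAB' (singleton_subset_iff.2 hA))
      (comap_measurable fun ω => ξ ω (Ioc s r ×ˢ D))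
    rw [lintegral_indicator_const hA₀, one_mul] at this
    rw [← this, ← lintegral_indicator hA₀]
    refine lintegral_congr fun ω => ?_
    by_cases hω : ω ∈ A <;> simp [hω]
  have key : ∫⁻ q, H (f q) ∂(P ⊗ₘ κ) = ∫⁻ q, H (f q) ∂(P.prod μ) := by
    refine lintegral_comp_eq_of_isPiSystem (m := (predictableSigma ℋ).prod mF) hf C hC ?_
      (fun n : ℕ => (Ioc (-(n : ℝ)) n ×ˢ univ) ×ˢ spanningSets ν n) ?_ ?_ ?_ hrect hH
    · exact (isPiSystem_predictableRectangles ℋ).prod MeasurableSpace.isPiSystem_measurableSet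
    · refine eq_univ_of_forall fun ⟨⟨t, ω⟩, z⟩ => mem_iUnion.2 ?_
      obtain ⟨n, hn⟩ := exists_nat_gt |t|
      have hz := mem_spanningSetsIndex ν z
      refine ⟨max n (spanningSetsIndex ν z), ⟨⟨?_, ?_⟩, mem_univ _⟩,
        monotone_spanningSets ν (le_max_right _ _) hz⟩ <;> simp only [Nat.cast_max]
      · have := le_max_left (n : ℝ) (spanningSetsIndex ν z)
        linarith [(abs_lt.1 hn).1]
      · exact (abs_lt.1 hn).2.le.trans (le_max_left _ _)
    · exact fun n => ⟨_, ⟨-n, n, univ, MeasurableSet.univ, rfl⟩, _,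
        measurableSet_spanningSets ν n, rfl⟩
    · intro n
      rw [hrect _ ⟨_, ⟨-n, n, univ, MeasurableSet.univ, rfl⟩, _,
        measurableSet_spanningSets ν n, rfl⟩, hpre, Measure.prod_prod, Measure.prod_prod]
      exact ENNReal.mul_ne_top (measure_ne_top P _) (ENNReal.mul_ne_top
        (by simp [Real.volume_Ioc]) (measure_spanningSets_lt_top ν n).ne)
  rw [Measure.lintegral_compProd (f := fun q => H (f q)) (hH₀.comp hf₀),
    lintegral_prod (fun q => H (f q)) (hH₀.comp hf₀).aemeasurable] at key
  rw [lintegral_congr_ae (hκ.mono fun ω hω => ?_)] at key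
  rotate_left
  · exact fun ω => ∫⁻ p, H ((p.1, ω), p.2) ∂ξ ω
  · simp only [hω]; rfl
  refine key.trans (lintegral_congr fun ω => ?_)
  exact lintegral_prod _
    (hH₀.comp (by fun_prop : Measurable fun p : ℝ × F => ((p.1, ω), p.2))).aemeasurable

end Predictable

/-! ### Configurations and their pasts -/

section Config

variable {I : Type*}

theorem Config.pointMeasure_apply (x : Config I) (i : I) {A : Set ℝ} (hA : MeasurableSet A) :
    x.pointMeasure i A = (x.points i ∩ A).encard := by
  rw [Config.pointMeasure, Measure.sum_apply _ hA, ← ENNReal.tsum_set_one,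
    tsum_subtype (x.points i ∩ A) fun _ => (1 : ℝ≥0∞), ← indicator_indicator,
    ← tsum_subtype (x.points i)]
  refine tsum_congr fun s => ?_
  rw [Measure.dirac_apply' _ hA]
  rfl

theorem Config.pointMeasure_Icc_ne_top (x : Config I) (i : I) (a b : ℝ) :
    x.pointMeasure i (Icc a b) ≠ ∞ := by
  rw [x.pointMeasure_apply i measurableSet_Icc]
  simpa using x.locallyFinite i a b

theorem shiftedPast_pointMeasure_apply (x : Config I) (t : ℝ) (i : I) {A : Set ℝ}
    (hA : MeasurableSet A) :
    (shiftedPast x t).1.pointMeasure i A =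
      (x.pointMeasure i).restrict (Iio t) ((fun s => s - t) ⁻¹' A) := by
  have hA' : MeasurableSet ((fun s => s - t) ⁻¹' A) := (measurable_id.sub_const t) hA
  rw [Measure.restrict_apply hA', Config.pointMeasure_apply _ _ hA,
    Config.pointMeasure_apply _ _ (hA'.inter measurableSet_Iio),
    ← (sub_left_injective (b := t)).encard_image (x.points i ∩ _)]
  congr 2
  ext r
  simp only [shiftedPast, mem_inter_iff, mem_ofPred_eq, mem_image, mem_preimage, mem_Iio]
  constructor
  · rintro ⟨⟨hr, hx⟩, hrA⟩
    exact ⟨r + t, ⟨hx, by simpa using hrA, by linarith⟩, by ring⟩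
  · rintro ⟨s, ⟨hs, hsA, hst⟩, rfl⟩
    exact ⟨⟨by linarith, by simpa using hs⟩, hsA⟩

/-- Times `t` are collected as long as there are at most `n` points in `(a, t)`; this captures at
most `n + 1` points, the last one not being counted by itself. -/
theorem Config.pointMeasure_stopped_le (x : Config I) (i : I) (a b : ℝ) (n : ℕ) :
    x.pointMeasure i (Ioc a b ∩ {t | x.pointMeasure i (Ioo a t) ≤ n}) ≤ n + 1 := by
  have hmono : Monotone fun t => x.pointMeasure i (Ioo a t) := fun s t hst =>
    measure_mono (Ioo_subset_Ioo_right hst)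
  have hS : MeasurableSet (Ioc a b ∩ {t | x.pointMeasure i (Ioo a t) ≤ n}) :=
    measurableSet_Ioc.inter (measurableSet_le hmono.measurable measurable_const)
  rw [x.pointMeasure_apply i hS]
  set T := x.points i ∩ (Ioc a b ∩ {t | x.pointMeasure i (Ioo a t) ≤ n})
  have hT : T.Finite := (x.locallyFinite i a b).subset fun t ht =>
    ⟨ht.1, Ioc_subset_Icc_self ht.2.1⟩
  rcases T.eq_empty_or_nonempty with hT0 | hT0
  · simp [hT0]
  obtain ⟨t, ht, hmax⟩ := exists_max_image T id hT hT0
  have hsub : T \ {t} ⊆ x.points i ∩ Ioo a t := fun s hs =>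
    ⟨hs.1.1, hs.1.2.1.1, lt_of_le_of_ne (hmax s hs.1) hs.2⟩
  have hle : ((T \ {t}).encard : ℝ≥0∞) ≤ n := by
    refine le_trans ?_ ht.2.2
    rw [x.pointMeasure_apply i measurableSet_Ioo]
    exact_mod_cast encard_le_encard hsub
  rw [← encard_sdiff_singleton_add_one ht]
  push_cast
  gcongr

variable {Ω : Type*} [mΩ : MeasurableSpace Ω]

theorem measurable_indicator_Ioi (ℱ : Filtration ℝ mΩ) (q : ℝ) {g : Ω → ℝ≥0∞}
    (hg : Measurable[ℱ q] g) :
    Measurable[predictableSigma ℱ]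
      ((Ioi q ×ˢ (univ : Set Ω)).indicator fun p : ℝ × Ω => g p.2) := by
  have hIoi : ∀ A, MeasurableSet[ℱ q] A → MeasurableSet[predictableSigma ℱ] (Ioi q ×ˢ A) :=
    fun A hA => MeasurableSpace.measurableSet_generateFrom ⟨q, A, hA, rfl⟩
  have hconst : Measurable[predictableSigma ℱ] fun _ : ℝ × Ω => (0 : ℝ≥0∞) := measurable_const
  intro B hB
  rw [indicator_preimage]
  have : (fun p : ℝ × Ω => g p.2) ⁻¹' B ∩ Ioi q ×ˢ univ = Ioi q ×ˢ (g ⁻¹' B) := by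
    ext ⟨t, ω⟩; simp [and_comm]
  rw [Set.ite, this]
  exact MeasurableSet.union (hIoi _ (hg hB)) ((hconst hB).diff (hIoi _ MeasurableSet.univ))

variable (X : Ω → Config I) (hX : Measurable X)

/-- The points strictly before `t` form a predictable process with values in the measures: by
continuity from below it suffices to know, after each rational time `q < t`, the points up to
time `q`. -/
theorem predictable_restrict_Iio (i : I) :
    Measurable[predictableSigma (pastFiltration X hX)]
      fun p : ℝ × Ω => ((X p.2).pointMeasure i).restrict (Iio p.1) := by
  refine @Measure.measurable_of_measurable_coe _ _ _ (predictableSigma (pastFiltration X hX)) _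
    fun A hA => ?_
  have heq : (fun p : ℝ × Ω => ((X p.2).pointMeasure i).restrict (Iio p.1) A) = fun p => ⨆ q : ℚ,
      (Ioi (q : ℝ) ×ˢ (univ : Set Ω)).indicator
        (fun p : ℝ × Ω => (X p.2).pointMeasure i (A ∩ Iic (q : ℝ))) p := by
    funext p
    have hU : A ∩ Iio p.1 = ⋃ q : {q : ℚ // (q : ℝ) < p.1}, A ∩ Iic ((q : ℚ) : ℝ) := by
      rw [← inter_iUnion]
      congr 1
      ext s
      simp only [mem_Iio, mem_iUnion, mem_Iic]
      constructor
      · intro hs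
        obtain ⟨q, hq1, hq2⟩ := exists_rat_btwn hs
        exact ⟨⟨q, hq2⟩, hq1.le⟩
      · rintro ⟨⟨q, hq⟩, hs⟩
        exact lt_of_le_of_lt hs hq
    have hmono : Monotone fun q : {q : ℚ // (q : ℝ) < p.1} => A ∩ Iic ((q : ℚ) : ℝ) :=
      fun q r hqr => inter_subset_inter_right A
        (Iic_subset_Iic.2 (Rat.cast_le.2 (Subtype.coe_le_coe.2 hqr)))
    rw [Measure.restrict_apply hA, hU, hmono.directed_le.measure_iUnion, iSup_subtype]
    refine iSup_congr fun q => ?_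
    by_cases hq : (q : ℝ) < p.1
    · simp [hq, indicator]
    · simp [hq, indicator]
  rw [heq]
  let := predictableSigma (pastFiltration X hX)
  refine Measurable.iSup fun q : ℚ => ?_
  refine measurable_indicator_Ioi (pastFiltration X hX) q
    (g := fun ω => (X ω).pointMeasure i (A ∩ Iic (q : ℝ))) ?_
  refine Measurable.mono (comap_measurable _) ?_ le_rfl
  exact le_iSup_of_le i (comap_apply_le_sigmaOn (hA.inter measurableSet_Iic) inter_subset_right)

/-- The masses of the shifted past are integrals against the points strictly before `t`, with an
integrand that depends on `t` through the shift only. -/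
theorem predictable_shiftedPast :
    Measurable[predictableSigma (pastFiltration X hX)]
      fun p : ℝ × Ω => shiftedPast (X p.2) p.1 := by
  refine @Measurable.subtype_mk _ _ (predictableSigma (pastFiltration X hX)) _ _ _ ?_ _
  refine measurable_comap_iff.2 ?_
  refine @measurable_pi_lambda _ _ _ (predictableSigma (pastFiltration X hX)) _ _ fun j => ?_
  refine @Measure.measurable_of_measurable_coe _ _ _ (predictableSigma (pastFiltration X hX)) _
    fun A hA => ?_
  have heq : (fun p : ℝ × Ω => (shiftedPast (X p.2) p.1).1.pointMeasure j A) = fun p =>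
      ∫⁻ s, A.indicator (fun _ => 1) (s - p.1) ∂((X p.2).pointMeasure j).restrict (Iio p.1) := by
    funext p
    rw [shiftedPast_pointMeasure_apply _ _ _ hA,
      ← lintegral_indicator_one (show MeasurableSet ((fun s => s - p.1) ⁻¹' A) from
        (measurable_id.sub_const p.1) hA)]
    rfl
  refine (congrArg (Measurable[predictableSigma (pastFiltration X hX)]) heq).mpr ?_
  refine @measurable_lintegral_of_cover _ _ (predictableSigma (pastFiltration X hX)) _ _
    (predictable_restrict_Iio X hX j) (fun n : ℕ => Icc (-(n : ℝ)) n) (fun n => measurableSet_Icc)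
    ?_ ?_ (fun q : (ℝ × Ω) × ℝ => A.indicator (fun _ => (1 : ℝ≥0∞)) (q.2 - q.1.1)) ?_
  · refine univ_subset_iff.1 (iUnion_Ioc_neg_nat.symm.subset.trans ?_)
    exact iUnion_mono fun n => Ioc_subset_Icc_self
  · intro n p
    exact ((Measure.restrict_apply_le _ _).trans_lt
      ((X p.2).pointMeasure_Icc_ne_top j _ _).lt_top).ne
  · have hfst : Measurable[predictableSigma (pastFiltration X hX)] fun p : ℝ × Ω => p.1 :=
      Measurable.mono (comap_measurable _) (comap_fst_le_predictableSigma _) le_rfl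
    refine (measurable_const.indicator hA).comp ?_
    let := predictableSigma (pastFiltration X hX)
    exact measurable_snd.sub (hfst.comp measurable_fst)

/-- The formula `E ∫ C dN = E ∫ C_t lam_t dt` forces the intensity to be locally integrable: with
`C` the indicator of the times `t` in `(-m, m]` such that there are at most `n` points in `(-m, t)`,
the left side is at most `n + 1`, and for large `n` the right side integrates over all of
`(-m, m]`. -/
theorem ae_lintegral_lt_top {P : Measure Ω} [IsProbabilityMeasure P] (i : I) {lam : ℝ → Ω → ℝ≥0∞}
    (hlam : Measurable[predictableSigma (pastFiltration X hX)] fun p : ℝ × Ω => lam p.1 p.2)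
    (h : ∀ C : ℝ × Ω → ℝ≥0∞, Measurable[predictableSigma (pastFiltration X hX)] C →
      ∫⁻ ω, (∫⁻ t : ℝ, C (t, ω) ∂((X ω).pointMeasure i)) ∂P =
        ∫⁻ ω, (∫⁻ t : ℝ, C (t, ω) * lam t ω) ∂P) :
    ∀ᵐ ω ∂P, ∀ a b : ℝ, ∫⁻ t in Ioc a b, lam t ω < ∞ := by
  let S : ℕ → ℕ → Set (ℝ × Ω) := fun m n =>
    Ioc (-(m : ℝ)) m ×ˢ univ ∩ {p | (X p.2).pointMeasure i (Ioo (-(m : ℝ)) p.1) ≤ n}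
  have hS : ∀ m n, MeasurableSet[predictableSigma (pastFiltration X hX)] (S m n) := by
    intro m n
    refine MeasurableSet.inter ?_ ?_
    · rw [← generateFrom_predictableRectangles]
      exact MeasurableSpace.measurableSet_generateFrom ⟨-m, m, univ, MeasurableSet.univ, rfl⟩
    · have h1 := (Measure.measurable_coe (measurableSet_Ioi (a := -(m : ℝ)))).comp
        (predictable_restrict_Iio X hX i)
      have h2 : (fun p : ℝ × Ω => (X p.2).pointMeasure i (Ioo (-(m : ℝ)) p.1)) =
          (fun ν : Measure ℝ => ν (Ioi (-(m : ℝ)))) ∘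
            fun p : ℝ × Ω => ((X p.2).pointMeasure i).restrict (Iio p.1) := by
        funext p
        simp only [Function.comp, Measure.restrict_apply measurableSet_Ioi, Ioi_inter_Iio]
      rw [← h2] at h1
      exact h1 measurableSet_Iic
  have hsec : ∀ m n ω, (fun t => (t, ω)) ⁻¹' S m n =
      Ioc (-(m : ℝ)) m ∩ {t | (X ω).pointMeasure i (Ioo (-(m : ℝ)) t) ≤ n} := by
    intro m n ω; ext t; simp [S]
  have hle := predictableSigma_le (pastFiltration X hX)
  have hfin : ∀ m n, ∀ᵐ ω ∂P, ∫⁻ t, (S m n).indicator (fun _ => 1) (t, ω) * lam t ω < ∞ := by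
    intro m n
    have hC : Measurable[predictableSigma (pastFiltration X hX)]
        ((S m n).indicator fun _ => (1 : ℝ≥0∞)) := measurable_const.indicator (hS m n)
    refine ae_lt_top ?_ ?_
    · exact Measurable.lintegral_prod_left'
        (f := fun p : ℝ × Ω => (S m n).indicator (fun _ => 1) p * lam p.1 p.2)
        ((hC.mono hle le_rfl).mul (hlam.mono hle le_rfl))
    · rw [← h _ hC]
      refine ((lintegral_mono fun ω => ?_).trans_lt (?_ : ∫⁻ _, (n + 1 : ℝ≥0∞) ∂P < ∞)).ne
      · have hm : MeasurableSet ((fun t => (t, ω)) ⁻¹' S m n) :=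
          measurable_prodMk_right (hle _ (hS m n))
        calc ∫⁻ t, (S m n).indicator (fun _ => 1) (t, ω) ∂((X ω).pointMeasure i)
            = ∫⁻ t, ((fun t => (t, ω)) ⁻¹' S m n).indicator 1 t ∂((X ω).pointMeasure i) := rfl
          _ = (X ω).pointMeasure i ((fun t => (t, ω)) ⁻¹' S m n) := lintegral_indicator_one hm
          _ ≤ n + 1 := by rw [hsec]; exact (X ω).pointMeasure_stopped_le i _ _ n
      · simp
  filter_upwards [ae_all_iff.2 fun m => ae_all_iff.2 (hfin m)] with ω hω a b
  obtain ⟨m, hm⟩ := exists_nat_ge (max (-a) b)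
  obtain ⟨n, hn⟩ := ENNReal.exists_nat_gt ((X ω).pointMeasure_Icc_ne_top i (-m) m)
  refine lt_of_le_of_lt ?_ (hω m n)
  rw [← lintegral_indicator measurableSet_Ioc]
  refine lintegral_mono fun t => ?_
  by_cases ht : t ∈ Ioc a b
  swap
  · simp [ht]
  have htm : t ∈ Ioc (-(m : ℝ)) m :=
    ⟨by linarith [ht.1, (le_max_left _ _).trans hm], ht.2.trans ((le_max_right _ _).trans hm)⟩
  have hmem : (t, ω) ∈ S m n := by
    refine ⟨⟨htm, mem_univ _⟩, (measure_mono ?_).trans hn.le⟩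
    exact fun s hs => ⟨hs.1.le, hs.2.le.trans htm.2⟩
  rw [indicator_of_mem ht, indicator_of_mem hmem, one_mul]

end Config

/-! ### The thinning equation -/

section Thinning

theorem lebesgueNNReal_Iic (c : ℝ≥0) : lebesgueNNReal (Iic c) = c := by
  have hemb : MeasurableEmbedding fun u : ℝ≥0 => (u : ℝ) :=
    MeasurableEmbedding.subtype_coe measurableSet_Ici
  have himage : (fun u : ℝ≥0 => (u : ℝ)) '' Iic c = Icc 0 (c : ℝ) := by
    ext r
    simp only [mem_image, mem_Iic, mem_Icc]
    constructor
    · rintro ⟨u, hu, rfl⟩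
      exact ⟨u.2, hu⟩
    · rintro ⟨h0, hc⟩
      exact ⟨⟨r, h0⟩, hc, rfl⟩
  rw [lebesgueNNReal, hemb.comap_apply, himage, Real.volume_Icc, sub_zero,
    ENNReal.ofReal_coe_nnreal]

instance sigmaFinite_lebesgueNNReal : SigmaFinite lebesgueNNReal :=
  ⟨⟨{ set := fun n => Iic (n : ℝ≥0)
      set_mem := fun _ => trivial
      finite := fun n => by rw [lebesgueNNReal_Iic]; exact ENNReal.coe_lt_top
      spanning := eq_univ_of_forall fun u => mem_iUnion.2 (exists_nat_ge u) }⟩⟩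

/-- The history of the random measures `π j`: the σ-algebra at time `t` is generated by `𝒢` and by
the restrictions of all `π j` to times in `(-∞, t]`. -/
def historyFiltration {I : Type*} {F : I → Type*} [∀ i, MeasurableSpace (F i)] {Ω : Type*}
    {𝒢 : MeasurableSpace Ω} [mΩ : MeasurableSpace Ω] (h𝒢 : 𝒢 ≤ mΩ)
    {π : ∀ i, Ω → Measure (ℝ × F i)} (hπ : ∀ i, Measurable (π i)) : Filtration ℝ mΩ where
  seq t := 𝒢 ⊔ ⨆ i, sigmaOn (π i) {p | p.1 ≤ t}
  mono' := by
    intro s t hst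
    refine sup_le_sup_left (iSup_mono fun i => iSup_mono fun B => iSup_mono fun _ => ?_) 𝒢
    exact iSup_le fun h => le_iSup_of_le (h.trans fun p hp => le_trans hp hst) le_rfl
  le' := fun t => sup_le h𝒢 (iSup_le fun i => sigmaOn_le (hπ i) _)

variable {I V : Type*} [Countable V] [MeasurableSpace V] [DiscreteMeasurableSpace V]

theorem measurableSet_le_of_countable {α : Type*} [MeasurableSpace α] {g : α → V → ℝ≥0}
    (hg : ∀ v, Measurable fun a => g a v) :
    MeasurableSet {q : α × ℝ≥0 × V | q.2.1 ≤ g q.1 q.2.2} := by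
  have : {q : α × ℝ≥0 × V | q.2.1 ≤ g q.1 q.2.2} =
      ⋃ v, {q | q.2.2 = v} ∩ {q : α × ℝ≥0 × V | q.2.1 ≤ g q.1 v} := by
    ext q; simp
  rw [this]
  refine MeasurableSet.iUnion fun v => MeasurableSet.inter ?_ ?_
  · exact (measurable_snd.comp measurable_snd) (measurableSet_singleton v)
  · exact measurableSet_le (measurable_fst.comp measurable_snd) ((hg v).comp measurable_fst)

theorem prod_lebesgueNNReal_subgraph (lam : Measure V) [SFinite lam] (g : V → ℝ≥0) :
    (lebesgueNNReal.prod lam) {z | z.1 ≤ g z.2} = ∑' v, lam {v} * (g v : ℝ≥0∞) := by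
  have hm : MeasurableSet {z : ℝ≥0 × V | z.1 ≤ g z.2} :=
    measurableSet_le measurable_fst ((Measurable.of_discrete (f := g)).comp measurable_snd)
  rw [Measure.prod_apply_symm hm, lintegral_countable']
  refine tsum_congr fun v => ?_
  rw [mul_comm]
  congr 1
  exact lebesgueNNReal_Iic (g v)

end Thinning

end Kalikow

theorem proposition1 {I : Type*} [Countable I]
    -- families of finite neighborhoods, indexed by countable discrete sets
    {V : I → Type*} [∀ i, Countable (V i)] [∀ i, MeasurableSpace (V i)]
    [∀ i, DiscreteMeasurableSpace (V i)]
    (nbhd : ∀ i, V i → Set (I × ℝ)) (hnbhd : ∀ i v, Kalikow.IsFiniteNeighborhood (nbhd i v))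
    -- probabilities on the families, and cylindrical functions
    (lam : ∀ i, Measure (V i)) [∀ i, IsProbabilityMeasure (lam i)]
    (φ : ∀ i, V i → Kalikow.PastConfig I → ℝ≥0) (hφ : ∀ i v, Measurable (φ i v))
    (hcyl : ∀ i v, Kalikow.IsCylindrical (nbhd i v) (φ i v))
    -- independent Poisson measures
    {Ω : Type*} (𝒢 : MeasurableSpace Ω) [mΩ : MeasurableSpace Ω] (P : Measure Ω) [IsProbabilityMeasure P]
    (π : ∀ i, Ω → Measure (ℝ × ℝ≥0 × V i))
    (hπ : ∀ i, Kalikow.IsPoissonMeasure P (π i)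
      ((volume : Measure ℝ).prod (Kalikow.lebesgueNNReal.prod (lam i))))
    (hind : iIndepFun π P)
    -- optional additional randomness (for instance null events), independent of all the `π i`
    (h𝒢 : 𝒢 ≤ mΩ)
    (h𝒢ind : Indep 𝒢 (⨆ i, MeasurableSpace.comap (π i) inferInstance) P)
    -- a random configuration that is adapted and solves the thinning equation
    (X : Ω → Kalikow.Config I) (hX : Measurable X)
    (hadapted : ∀ t : ℝ, Kalikow.pastFiltration X hX t ≤
      𝒢 ⊔ ⨆ i, Kalikow.sigmaOn (π i) {p | p.1 ≤ t})
    (hthin : ∀ᵐ ω ∂P, ∀ i, (X ω).pointMeasure i = Kalikow.thinning (π i ω) (φ i) (X ω)) :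
    ∀ i, Kalikow.HasGenericIntensity P X hX i
      (fun x => ∑' v, lam i {v} * (φ i v x : ℝ≥0∞)) := by
  intro i
  have hmeas : Measurable fun x : Kalikow.PastConfig I => ∑' v, lam i {v} * (φ i v x : ℝ≥0∞) :=
    Measurable.tsum fun v => (hφ i v).coe_nnreal_ennreal.const_mul _
  let ℱ := Kalikow.pastFiltration X hX
  let ℋ := Kalikow.historyFiltration h𝒢 fun i => (hπ i).measurable
  have hFH : Kalikow.predictableSigma ℱ ≤ Kalikow.predictableSigma ℋ :=
    Kalikow.predictableSigma_mono hadapted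
  have hle := Kalikow.predictableSigma_le ℱ
  have hshift := Kalikow.predictable_shiftedPast X hX
  have hpred := hmeas.comp hshift
  -- `S` is the set of the points `((t, ω), (u, v))` that are kept by the thinning
  let S : Set ((ℝ × Ω) × ℝ≥0 × V i) :=
    {q | q.2.1 ≤ φ i q.2.2 (Kalikow.shiftedPast (X q.1.2) q.1.1)}
  have hS : MeasurableSet[(Kalikow.predictableSigma ℱ).prod inferInstance] S :=
    @Kalikow.measurableSet_le_of_countable (V i) _ _ _ _ (Kalikow.predictableSigma ℱ) _
      fun v => (hφ i v).comp hshift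
  have hS₀ : MeasurableSet S := Kalikow.measurableSet_le_of_countable
    (g := fun (p : ℝ × Ω) v => φ i v (Kalikow.shiftedPast (X p.2) p.1))
    fun v => (hφ i v).comp (hshift.mono hle le_rfl)
  have hformula : ∀ C : ℝ × Ω → ℝ≥0∞, Measurable[Kalikow.predictableSigma ℱ] C →
      ∫⁻ ω, (∫⁻ t : ℝ, C (t, ω) ∂((X ω).pointMeasure i)) ∂P =
        ∫⁻ ω, (∫⁻ t : ℝ, C (t, ω) *
          ∑' v, lam i {v} * (φ i v (Kalikow.shiftedPast (X ω) t) : ℝ≥0∞)) ∂P := by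
    intro C hC
    let H : (ℝ × Ω) × ℝ≥0 × V i → ℝ≥0∞ := S.indicator fun q => C q.1
    have hH : Measurable[(Kalikow.predictableSigma ℱ).prod inferInstance] H :=
      (hC.comp (@measurable_fst _ _ (Kalikow.predictableSigma ℱ) _)).indicator hS
    have hH' : Measurable[(Kalikow.predictableSigma ℋ).prod inferInstance] H :=
      hH.mono (sup_le_sup (MeasurableSpace.comap_mono hFH) le_rfl) le_rfl
    have hcomp := (hπ i).lintegral_predictable ℋ (fun s B hB hBs =>
      Kalikow.indep_history hπ hind h𝒢 h𝒢ind (fun _ => {p | p.1 ≤ s}) i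
        (measurable_fst measurableSet_Iic) hB
        (Set.disjoint_left.2 fun p (hp : p.1 ≤ s) hpB => hp.not_gt (hBs hpB))) hH'
    have hleft : ∫⁻ ω, (∫⁻ t : ℝ, C (t, ω) ∂((X ω).pointMeasure i)) ∂P =
        ∫⁻ ω, ∫⁻ p, H ((p.1, ω), p.2) ∂π i ω ∂P := by
      refine lintegral_congr_ae (hthin.mono fun ω hω => ?_)
      have hCω : Measurable fun t => C (t, ω) := (hC.mono hle le_rfl).comp measurable_prodMk_right
      have hSω : MeasurableSet {p : ℝ × ℝ≥0 × V i |
          p.2.1 ≤ φ i p.2.2 (Kalikow.shiftedPast (X ω) p.1)} :=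
        (by fun_prop : Measurable fun p : ℝ × ℝ≥0 × V i => ((p.1, ω), p.2)) hS₀
      simp only [hω i, Kalikow.thinning]
      rw [lintegral_map hCω measurable_fst, ← lintegral_indicator hSω]
      rfl
    rw [hleft, hcomp]
    refine lintegral_congr fun ω => lintegral_congr fun t => ?_
    have hm : MeasurableSet {z : ℝ≥0 × V i | z.1 ≤ φ i z.2 (Kalikow.shiftedPast (X ω) t)} :=
      measurable_prodMk_left (x := (t, ω)) hS₀
    rw [← Kalikow.prod_lebesgueNNReal_subgraph, ← lintegral_indicator_const hm]
    rfl
  exact ⟨hmeas, hpred, Kalikow.ae_lintegral_lt_top X hX i hpred hformula, hformula⟩
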